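/- Let $P\subset\mathbb{R}^2$ be an open polygon (the interior of a simple closed polygonal line) of diameter $h_P$. Assume that, for some $\gamma>0$, $P$ is star-shaped with respect to a ball of radius greater than $\gamma h_P$ and every edge of $P$ has length at least $\gamma h_P$. For an integer $d$ let $\mathbb{P}_d(P)$ be the space of polynomials of degree at most $d$ on $P$ (with $\mathbb{P}_{-1}(P)=\{0\}$), and set $a^P(u,v)=\int_P\nabla u\cdot\nabla v\,dx$ and $b^P(u,v)=\int_P uv\,dx$. Fix $k\ge 1$ and put $$\tilde V_h^k(P)=\{v\in H^1(P): v|_{\partial P}\in C^0(\partial P),\ v|_e\in\mathbb{P}_k(e)\text{ for every edge } e,\ \Delta v\in\mathbb{P}_k(P)\}.$$ For $v\in\tilde V_h^k(P)$ let $\Pi^\nabla v\in\mathbb{P}_k(P)$ be determined by $a^P(\Pi^\nabla v-v,p)=0$ for all $p\in\mathbb{P}_k(P)$ and $\int_{\partial P}(\Pi^\nabla v-v)\,ds=0$. Let $$V_h^k(P)=\{v\in\tilde V_h^k(P):\ b^P(v-\Pi^\nabla v,p)=0\text{ for all }p\in\mathbb{P}_k(P)\text{ that are }L^2(P)\text{-orthogonal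 to }\mathbb{P}_{k-2}(P)\},$$ and let $\Pi^0$ be the $L^2(P)$-orthogonal projection onto $\mathbb{P}_k(P)$. Let $(\phi_i)$ be any finite basis of $V_h^k(P)$ and define the matrices $$(A_1^P)_{ij}=a^P(\Pi^\nabla\phi_i,\Pi^\nabla\phi_j),\qquad (A_2^P)_{ij}=a^P((I-\Pi^\nabla)\phi_i,(I-\Pi^\nabla)\phi_j),$$ $$(B_1^P)_{ij}=b^P(\Pi^0\phi_i,\Pi^0\phi_j),\qquad (B_2^P)_{ij}=b^P((I-\Pi^0)\phi_i,(I-\Pi^0)\phi_j).$$ For a pair of symmetric matrices $C_1,C_2$ consider the properties a) $C_1$ is positive semidefinite; b) $C_2$ is positive semidefinite, and positive definite on $\ker C_1$; c) $C_2$ vanishes on $(\ker C_1)^\perp$. Here coefficient vectors are identified with elements of $V_h^k(P)$ through the basis, and the orthogonal complement is taken with respect to $a^P$ for the pair $A_1^P,A_2^P$ (that is, $v\in(\ker A_1^P)^\perp$ if and only if $a^P(v,w)=0$ for all $w\in\ker A_1^P$) and with respect to $b^P$ for the pair $B_1^P,B_2^P$. Then the following hold. 1. $A_2^P$ vanishes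 on $(\ker A_1^P)^\perp$, so property c) holds for $A_1^P,A_2^P$. 2. The constant functions belong to $V_h^k(P)$ and lie in $\ker A_1^P\cap\ker A_2^P$. The matrices $A_1^P$ and $A_2^P$ are positive semidefinite, so property a) holds, but property b) fails for $A_1^P,A_2^P$. 3. Consequently $n_{12}=\dim(\ker A_1^P\cap\ker A_2^P)>0$; for all $\alpha,\beta>0$ the matrix $B_1^P+\beta B_2^P$ is positive definite, and $0$ is an eigenvalue of the problem $(A_1^P+\alpha A_2^P)x=\lambda(B_1^P+\beta B_2^P)x$ with multiplicity exactly $n_{12}$. 4. The matrices $B_1^P,B_2^P$ are symmetric and satisfy all of a), b) and c). -/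

import Mathlib

open MeasureTheory Filter Topology Matrix
open scoped ENNReal ContDiff Distributions Gradient

noncomputable section

namespace VEM

/-- The Euclidean plane. -/
abbrev Plane := EuclideanSpace ℝ (Fin 2)

/-! ### Splittings of symmetric matrices -/

section Splitting

variable {ι : Type*} [Fintype ι]

/-- Property a): `C₁` is (symmetric) positive semidefinite. -/
def PropertyA (C₁ : Matrix ι ι ℝ) : Prop := C₁.PosSemidef

/-- Property b): `C₂` is positive semidefinite, and positive definite on the kernel of `C₁`. -/
def PropertyB (C₁ C₂ : Matrix ι ι ℝ) : Prop :=
  C₂.PosSemidef ∧ ∀ x : ι → ℝ, C₁ *ᵥ x = 0 → x ≠ 0 → 0 < x ⬝ᵥ (C₂ *ᵥ x)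

/-- Property c): `C₂` vanishes on the orthogonal complement of the kernel of `C₁`, where
orthogonality is taken with respect to the symmetric bilinear form with matrix `G`
(the Euclidean inner product being `G = 1`). -/
def PropertyC (G C₁ C₂ : Matrix ι ι ℝ) : Prop :=
  ∀ x : ι → ℝ, (∀ y : ι → ℝ, C₁ *ᵥ y = 0 → x ⬝ᵥ (G *ᵥ y) = 0) → C₂ *ᵥ x = 0

/-- The standing assumption on a pair of matrices `C₁`, `C₂` (in the splitting `C₁ + γ C₂`), with
orthogonality taken with respect to the bilinear form with matrix `G`. -/
structure SplittingAssumption (G C₁ C₂ : Matrix ι ι ℝ) : Prop where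
  symm₁ : C₁.IsSymm
  symm₂ : C₂.IsSymm
  a : PropertyA C₁
  b : PropertyB C₁ C₂
  c : PropertyC G C₁ C₂

/-- The solutions `x` of the generalized eigenvalue problem `A x = lam B x`. -/
def eigenSolutions (A B : Matrix ι ι ℝ) (lam : ℝ) : Submodule ℝ (ι → ℝ) :=
  LinearMap.ker (A - lam • B).mulVecLin

end Splitting

/-! ### Polygonal elements -/

/-- A polygon in the plane: the nonempty bounded open set `carrier` whose boundary is a simple
closed polygonal line. Consecutive edges may be collinear. -/
structure PolygonalDomain where
  n : ℕ
  three_le : 3 ≤ n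
  poly : Polygon Plane n
  vertices_injective : Function.Injective poly.vertices
  /-- distinct edges meet at most at common endpoints -/
  simple : ∀ i j : Fin n, i ≠ j → poly.edgeSet ℝ i ∩ poly.edgeSet ℝ j ⊆
    {poly i, poly (finRotate n i)} ∩ {poly j, poly (finRotate n j)}
  carrier : TopologicalSpace.Opens Plane
  nonempty : (carrier : Set Plane).Nonempty
  isBounded : Bornology.IsBounded (carrier : Set Plane)
  frontier_eq : frontier (carrier : Set Plane) = poly.boundary ℝ

namespace PolygonalDomain

variable (P : PolygonalDomain)

/-- The length of the `i`-th edge. -/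
def edgeLength (i : Fin P.n) : ℝ := dist (P.poly i) (P.poly (finRotate P.n i))

/-- The diameter of the polygon. -/
def diam : ℝ := Metric.diam (P.carrier : Set Plane)

/-- The mesh regularity condition with constant `γ`: the polygon is star-shaped with respect to
a ball of radius greater than `γ` times the diameter, and no edge is shorter than `γ` times the
diameter. -/
def MeshRegular (γ : ℝ) : Prop :=
  (∃ (z : Plane) (ρ : ℝ), γ * P.diam < ρ ∧
    ∀ y ∈ Metric.ball z ρ, StarConvex ℝ y (P.carrier : Set Plane)) ∧
  ∀ i, γ * P.diam ≤ P.edgeLength i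

/-- Lebesgue measure on the polygon. -/
abbrev area : Measure Plane := volume.restrict (P.carrier : Set Plane)

/-- Arc length on the boundary of the polygon: the sum over the edges of the image of Lebesgue
measure on `[0, 1]`, scaled by the length of the edge, under the affine parametrization. -/
def arcLength : Measure Plane :=
  ∑ i : Fin P.n, ENNReal.ofReal (P.edgeLength i) •
    (volume.restrict (Set.Icc (0 : ℝ) 1)).map (P.poly.edgePath ℝ i)

/-- `L²(P)` -/
abbrev L2 := Lp ℝ 2 P.area

/-- `L²(P)²` -/
abbrev L2Vec := Lp Plane 2 P.area

instance : IsFiniteMeasure P.area :=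
  ⟨by simpa using P.isBounded.measure_lt_top⟩

instance : IsFiniteMeasure P.arcLength := by
  unfold arcLength
  refine ⟨?_⟩
  rw [Measure.finsetSum_apply]
  refine ENNReal.sum_lt_top.2 fun i _ => ?_
  rw [Measure.smul_apply, smul_eq_mul]
  exact ENNReal.mul_lt_top ENNReal.ofReal_lt_top (measure_lt_top _ _)

end PolygonalDomain

variable {P : PolygonalDomain}

lemma memLp_of_continuous {F : Type*} [NormedAddCommGroup F]
    [SecondCountableTopology F] {f : Plane → F} (hf : Continuous f) : MemLp f 2 P.area := by
  obtain ⟨C, hC⟩ := (P.isBounded.isCompact_closure).exists_bound_of_continuousOn hf.continuousOn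
  refine MemLp.of_bound hf.aestronglyMeasurable C ?_
  filter_upwards [ae_restrict_mem P.carrier.isOpen.measurableSet] with x hx
  exact hC x (subset_closure hx)

lemma integrable_arcLength {f : Plane → ℝ} (hf : Continuous f) : Integrable f P.arcLength := by
  unfold PolygonalDomain.arcLength
  rw [integrable_finsetSum_measure]
  intro i _
  refine Integrable.smul_measure ?_ ENNReal.ofReal_ne_top
  have hc : Continuous (P.poly.edgePath ℝ i) := AffineMap.continuous_of_finiteDimensional _
  rw [integrable_map_measure hf.aestronglyMeasurable hc.aemeasurable]
  exact (hf.comp hc).continuousOn.integrableOn_compact isCompact_Icc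

lemma integral_mul_eq_inner (v : P.L2) {w : Plane → ℝ} (hw : MemLp w 2 P.area) :
    ∫ x, v x * w x ∂P.area = inner ℝ v (hw.toLp w) := by
  rw [L2.inner_def]
  refine integral_congr_ae ?_
  filter_upwards [hw.coeFn_toLp] with x hx
  simp [hx, mul_comm]

lemma integral_inner_eq_inner (v : P.L2Vec) {w : Plane → Plane} (hw : MemLp w 2 P.area) :
    ∫ x, inner ℝ (v x) (w x) ∂P.area = inner ℝ v (hw.toLp w) := by
  rw [L2.inner_def]
  refine integral_congr_ae ?_
  filter_upwards [hw.coeFn_toLp] with x hx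
  simp [hx]

/-! ### The Sobolev space `H¹(P)` -/

/-- `G` is the weak gradient of `v` on `P`. -/
def HasWeakGradient (v : P.L2) (G : P.L2Vec) : Prop :=
  ∀ (ψ : 𝓓(P.carrier, ℝ)) (e : Plane),
    ∫ x, v x * fderiv ℝ ψ x e ∂P.area = -∫ x, inner ℝ (G x) (ψ x • e) ∂P.area

lemma continuous_fderiv_test (ψ : 𝓓(P.carrier, ℝ)) : Continuous (fderiv ℝ ψ) :=
  ψ.contDiff.continuous_fderiv (by simp)

lemma hasWeakGradient_iff (v : P.L2) (G : P.L2Vec) :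
    HasWeakGradient v G ↔ ∀ (ψ : 𝓓(P.carrier, ℝ)) (e : Plane),
      inner ℝ v ((memLp_of_continuous (P := P)
        ((continuous_fderiv_test ψ).clm_apply continuous_const)).toLp
          (fun x => fderiv ℝ ψ x e)) =
      -inner ℝ G ((memLp_of_continuous (P := P)
        (ψ.continuous.smul continuous_const)).toLp (fun x => ψ x • e)) := by
  unfold HasWeakGradient
  refine forall₂_congr fun ψ e => ?_
  rw [← integral_mul_eq_inner, ← integral_inner_eq_inner]

variable (P) in
/-- The Sobolev space `H¹(P)`: pairs of a function in `L²(P)` and its weak gradient in `L²(P)²`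
(the second component is determined by the first). -/
def H1 : Submodule ℝ (P.L2 × P.L2Vec) where
  carrier := {v | HasWeakGradient v.1 v.2}
  zero_mem' := by
    simp [hasWeakGradient_iff]
  add_mem' := by
    intro u v hu hv
    simp only [Set.mem_ofPred_eq, hasWeakGradient_iff] at *
    intro ψ e
    simp only [Prod.fst_add, Prod.snd_add, inner_add_left]
    rw [hu ψ e, hv ψ e]; ring
  smul_mem' := by
    intro c v hv
    simp only [Set.mem_ofPred_eq, hasWeakGradient_iff] at *
    intro ψ e
    simp only [Prod.smul_fst, Prod.smul_snd, real_inner_smul_left]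
    rw [hv ψ e]; ring

/-- The function in `L²(P)` underlying an element of `H¹(P)`. -/
def val : H1 P →ₗ[ℝ] P.L2 := LinearMap.fst ℝ _ _ ∘ₗ (H1 P).subtype

/-- The weak gradient of an element of `H¹(P)`. -/
def grad : H1 P →ₗ[ℝ] P.L2Vec := LinearMap.snd ℝ _ _ ∘ₗ (H1 P).subtype

/-- The bilinear form `a^P(u, v) = (∇u, ∇v)_P`. -/
def aForm (u v : H1 P) : ℝ := inner ℝ (grad u) (grad v)

/-- The bilinear form `b^P(u, v) = (u, v)_P`. -/
def bForm (u v : P.L2) : ℝ := inner ℝ u v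

/-- `f` is the distributional Laplacian of `v` on `P`. -/
def HasWeakLaplacian (v : H1 P) (f : P.L2) : Prop :=
  ∀ ψ : 𝓓(P.carrier, ℝ),
    ∫ x, inner ℝ (grad v x) (∇ ψ x) ∂P.area = -∫ x, f x * ψ x ∂P.area

lemma continuous_gradient {f : Plane → ℝ} (hf : Continuous (fderiv ℝ f)) : Continuous (∇ f) :=
  (InnerProductSpace.toDual ℝ Plane).symm.continuous.comp hf

lemma hasWeakLaplacian_iff (v : H1 P) (f : P.L2) :
    HasWeakLaplacian v f ↔ ∀ ψ : 𝓓(P.carrier, ℝ),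
      inner ℝ (grad v) ((memLp_of_continuous (P := P)
        (continuous_gradient (continuous_fderiv_test ψ))).toLp (∇ ψ)) =
      -inner ℝ f ((memLp_of_continuous (P := P) ψ.continuous).toLp ψ) := by
  unfold HasWeakLaplacian
  refine forall_congr' fun ψ => ?_
  rw [← integral_mul_eq_inner, ← integral_inner_eq_inner]

/-- `g` restricted to the boundary of `P` is the trace of `v`, that is, `g` is on the boundary the
`L²`-limit of the boundary values of functions smooth up to the boundary that converge to `v` in
`H¹(P)`. Only continuous traces are needed; a continuous function on the (compact) boundary is
the same as the restriction of a continuous function on the plane. -/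
def HasContinuousTrace (v : H1 P) (g : Plane → ℝ) : Prop :=
  Continuous g ∧ ∃ u : ℕ → Plane → ℝ, (∀ m, ContDiff ℝ ∞ (u m)) ∧
    Tendsto (fun m => eLpNorm (u m - (val v : Plane → ℝ)) 2 P.area) atTop (𝓝 0) ∧
    Tendsto (fun m => eLpNorm (∇ (u m) - (grad v : Plane → Plane)) 2 P.area) atTop (𝓝 0) ∧
    Tendsto (fun m => eLpNorm (u m - g) 2 P.arcLength) atTop (𝓝 0)

/-! ### Polynomials -/

/-- Polynomials in two variables of total degree at most `d`; this is `{0}` for `d < 0`. -/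
def polySpace : ℤ → Submodule ℝ (MvPolynomial (Fin 2) ℝ)
  | Int.ofNat d => MvPolynomial.restrictTotalDegree (Fin 2) ℝ d
  | Int.negSucc _ => ⊥

instance (d : ℤ) : FiniteDimensional ℝ (polySpace d) := by
  cases d <;> unfold polySpace <;> infer_instance

/-- The function on the plane defined by a polynomial. -/
def polyFun (q : MvPolynomial (Fin 2) ℝ) (x : Plane) : ℝ := MvPolynomial.eval (fun i => x i) q

lemma contDiff_polyFun (q : MvPolynomial (Fin 2) ℝ) : ContDiff ℝ ∞ (polyFun q) := by
  unfold polyFun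
  induction q using MvPolynomial.induction_on with
  | C a => simpa using contDiff_const
  | add p q hp hq => simpa using hp.add hq
  | mul_X p i hp =>
    have : ContDiff ℝ ∞ (fun x : Plane => x i) := by fun_prop
    simpa using hp.mul this

lemma continuous_gradient_polyFun (q : MvPolynomial (Fin 2) ℝ) : Continuous (∇ (polyFun q)) :=
  continuous_gradient ((contDiff_polyFun q).continuous_fderiv (by simp))

lemma differentiable_polyFun (q : MvPolynomial (Fin 2) ℝ) : Differentiable ℝ (polyFun q) :=
  (contDiff_polyFun q).differentiable (by simp)

lemma polyFun_add (p q : MvPolynomial (Fin 2) ℝ) : polyFun (p + q) = polyFun p + polyFun q := by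
  ext x; simp [polyFun]

lemma polyFun_smul (c : ℝ) (q : MvPolynomial (Fin 2) ℝ) : polyFun (c • q) = c • polyFun q := by
  ext x; simp [polyFun]

lemma gradient_polyFun_add (p q : MvPolynomial (Fin 2) ℝ) :
    ∇ (polyFun (p + q)) = ∇ (polyFun p) + ∇ (polyFun q) := by
  ext1 x
  simp only [gradient, polyFun_add, Pi.add_apply]
  rw [fderiv_add (differentiable_polyFun p x) (differentiable_polyFun q x), map_add]

lemma gradient_polyFun_smul (c : ℝ) (q : MvPolynomial (Fin 2) ℝ) :
    ∇ (polyFun (c • q)) = c • ∇ (polyFun q) := by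
  ext1 x
  simp only [gradient, polyFun_smul, Pi.smul_apply]
  rw [fderiv_const_smul (differentiable_polyFun q x)]
  simp

variable (P) in
/-- A polynomial as an element of `L²(P)`. -/
def polyL2 : MvPolynomial (Fin 2) ℝ →ₗ[ℝ] P.L2 where
  toFun q := (memLp_of_continuous (P := P) (contDiff_polyFun q).continuous).toLp (polyFun q)
  map_add' p q := by
    rw [← MemLp.toLp_add]
    exact MemLp.toLp_congr _ _ (by rw [polyFun_add])
  map_smul' c q := by
    rw [RingHom.id_apply, ← MemLp.toLp_const_smul]
    exact MemLp.toLp_congr _ _ (by rw [polyFun_smul])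

variable (P) in
/-- The gradient of a polynomial as an element of `L²(P)²`. -/
def polyGrad : MvPolynomial (Fin 2) ℝ →ₗ[ℝ] P.L2Vec where
  toFun q := (memLp_of_continuous (P := P) (continuous_gradient_polyFun q)).toLp (∇ (polyFun q))
  map_add' p q := by
    rw [← MemLp.toLp_add]
    exact MemLp.toLp_congr _ _ (by rw [gradient_polyFun_add])
  map_smul' c q := by
    rw [RingHom.id_apply, ← MemLp.toLp_const_smul]
    exact MemLp.toLp_congr _ _ (by rw [gradient_polyFun_smul])

lemma hasWeakGradient_poly (q : MvPolynomial (Fin 2) ℝ) :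
    HasWeakGradient (polyL2 P q) (polyGrad P q) := by
  intro ψ e
  have hψ : ∀ x ∉ (P.carrier : Set Plane), x ∉ tsupport ψ := fun x hx h =>
    hx (ψ.tsupport_subset h)
  have h1 : ∫ x, polyL2 P q x * fderiv ℝ ψ x e ∂P.area
      = ∫ x, polyFun q x * fderiv ℝ ψ x e := by
    rw [← setIntegral_eq_integral_of_forall_compl_eq_zero (s := (P.carrier : Set Plane))
      (f := fun x => polyFun q x * fderiv ℝ ψ x e)]
    · refine integral_congr_ae ?_
      filter_upwards [(memLp_of_continuous (P := P) (contDiff_polyFun q).continuous).coeFn_toLp]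
        with x hx
      have : polyL2 P q x = polyFun q x := hx
      rw [this]
    · intro x hx
      have h0 : fderiv ℝ ψ x = 0 := image_eq_zero_of_notMem_tsupport fun h =>
        hψ x hx (tsupport_fderiv_subset ℝ h)
      simp [h0]
  have h2 : ∫ x, inner ℝ (polyGrad P q x) (ψ x • e) ∂P.area
      = ∫ x, fderiv ℝ (polyFun q) x e * ψ x := by
    rw [← setIntegral_eq_integral_of_forall_compl_eq_zero (s := (P.carrier : Set Plane))
      (f := fun x => fderiv ℝ (polyFun q) x e * ψ x)]
    · refine integral_congr_ae ?_
      filter_upwards [(memLp_of_continuous (P := P) (continuous_gradient_polyFun q)).coeFn_toLp]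
        with x hx
      have : polyGrad P q x = ∇ (polyFun q) x := hx
      rw [this, real_inner_smul_right, gradient, InnerProductSpace.toDual_symm_apply, mul_comm]
    · intro x hx
      rw [image_eq_zero_of_notMem_tsupport (hψ x hx)]
      simp
  rw [h1, h2]
  have hq := (contDiff_polyFun q)
  have hqd : Continuous (fun x => fderiv ℝ (polyFun q) x e) :=
    (hq.continuous_fderiv (by simp)).clm_apply continuous_const
  have hψd : Continuous (fun x => fderiv ℝ ψ x e) :=
    (continuous_fderiv_test ψ).clm_apply continuous_const
  refine integral_mul_fderiv_eq_neg_fderiv_mul_of_integrable ?_ ?_ ?_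
    (fun x _ => differentiable_polyFun q x)
    (fun x _ => ψ.contDiff.differentiable (by simp) x)
  · exact (hqd.mul ψ.continuous).integrable_of_hasCompactSupport ψ.hasCompactSupport.mul_left
  · exact (hq.continuous.mul hψd).integrable_of_hasCompactSupport
      (ψ.hasCompactSupport.fderiv_apply (𝕜 := ℝ) e).mul_left
  · exact (hq.continuous.mul ψ.continuous).integrable_of_hasCompactSupport
      ψ.hasCompactSupport.mul_left

variable (P) in
/-- A polynomial as an element of `H¹(P)`. -/
def polyH1 : MvPolynomial (Fin 2) ℝ →ₗ[ℝ] H1 P :=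
  ((polyL2 P).prod (polyGrad P)).codRestrict (H1 P) fun q => hasWeakGradient_poly q

variable (P) in
/-- The polynomials of degree at most `d` as a subspace of `L²(P)`. -/
def polyL2Space (d : ℤ) : Submodule ℝ P.L2 := (polySpace d).map (polyL2 P)

instance (d : ℤ) : FiniteDimensional ℝ (polyL2Space P d) := by
  unfold polyL2Space; infer_instance

/-! ### The virtual element space and its projections -/

lemma HasContinuousTrace.zero : HasContinuousTrace (0 : H1 P) 0 := by
  refine ⟨continuous_const, fun _ => 0, fun _ => contDiff_const, ?_, ?_, ?_⟩
  · have h : ∀ m : ℕ, eLpNorm ((fun _ => 0 : Plane → ℝ) - (val (0 : H1 P) : Plane → ℝ)) 2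
        P.area = 0 := by
      intro m
      rw [map_zero, eLpNorm_congr_ae (g := 0), eLpNorm_zero]
      filter_upwards [Lp.coeFn_zero ℝ 2 P.area] with x hx
      rw [Pi.sub_apply, hx]; simp
    exact tendsto_const_nhds.congr fun m => (h m).symm
  · have h : ∀ m : ℕ, eLpNorm (∇ (fun _ => 0 : Plane → ℝ) - (grad (0 : H1 P) : Plane → Plane)) 2
        P.area = 0 := by
      intro m
      rw [map_zero, eLpNorm_congr_ae (g := 0), eLpNorm_zero]
      filter_upwards [Lp.coeFn_zero Plane 2 P.area] with x hx
      rw [Pi.sub_apply, hx]; simp [gradient]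
    exact tendsto_const_nhds.congr fun m => (h m).symm
  · simp

lemma tendsto_eLpNorm_add {F : Type*} [NormedAddCommGroup F] {μ : Measure Plane}
    {f g : ℕ → Plane → F} {f' g' h' : Plane → F} (h : h' =ᵐ[μ] f' + g')
    (hfm : ∀ m, AEStronglyMeasurable (f m - f') μ) (hgm : ∀ m, AEStronglyMeasurable (g m - g') μ)
    (hf : Tendsto (fun m => eLpNorm (f m - f') 2 μ) atTop (𝓝 0))
    (hg : Tendsto (fun m => eLpNorm (g m - g') 2 μ) atTop (𝓝 0)) :
    Tendsto (fun m => eLpNorm (f m + g m - h') 2 μ) atTop (𝓝 0) := by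
  refine tendsto_of_tendsto_of_tendsto_of_le_of_le tendsto_const_nhds
    (by simpa using hf.add hg) (fun _ => zero_le) fun m => ?_
  have : f m + g m - h' =ᵐ[μ] (f m - f') + (g m - g') := by
    filter_upwards [h] with x hx
    simp only [Pi.add_apply, Pi.sub_apply, hx]
    abel
  rw [eLpNorm_congr_ae this]
  exact eLpNorm_add_le (hfm m) (hgm m) (by norm_num)

lemma tendsto_eLpNorm_smul {F : Type*} [NormedAddCommGroup F] [NormedSpace ℝ F]
    {μ : Measure Plane} (c : ℝ) {f : ℕ → Plane → F} {f' h' : Plane → F} (h : h' =ᵐ[μ] c • f')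
    (hf : Tendsto (fun m => eLpNorm (f m - f') 2 μ) atTop (𝓝 0)) :
    Tendsto (fun m => eLpNorm (c • f m - h') 2 μ) atTop (𝓝 0) := by
  have key : ∀ m, eLpNorm (c • f m - h') 2 μ = ‖c‖ₑ * eLpNorm (f m - f') 2 μ := by
    intro m
    have : c • f m - h' =ᵐ[μ] c • (f m - f') := by
      filter_upwards [h] with x hx
      simp only [Pi.smul_apply, Pi.sub_apply, hx, smul_sub]
    rw [eLpNorm_congr_ae this, eLpNorm_const_smul]
  simp_rw [key]
  simpa using ENNReal.Tendsto.const_mul hf (Or.inr (by simp))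

lemma HasContinuousTrace.add {v v' : H1 P} {g g' : Plane → ℝ} (h : HasContinuousTrace v g)
    (h' : HasContinuousTrace v' g') : HasContinuousTrace (v + v') (g + g') := by
  obtain ⟨hg, u, hu, h1, h2, h3⟩ := h
  obtain ⟨hg', u', hu', h1', h2', h3'⟩ := h'
  refine ⟨hg.add hg', fun m => u m + u' m, fun m => (hu m).add (hu' m), ?_, ?_, ?_⟩
  · exact tendsto_eLpNorm_add (by rw [map_add]; exact Lp.coeFn_add _ _)
      (fun m => (hu m).continuous.aestronglyMeasurable.sub (Lp.aestronglyMeasurable _))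
      (fun m => (hu' m).continuous.aestronglyMeasurable.sub (Lp.aestronglyMeasurable _)) h1 h1'
  · have hgr : ∀ m, ∇ (u m + u' m) = ∇ (u m) + ∇ (u' m) := by
      intro m
      ext1 x
      simp only [gradient, Pi.add_apply]
      rw [fderiv_add ((hu m).differentiable (by simp) x) ((hu' m).differentiable (by simp) x),
        map_add]
    have hc : ∀ {f : Plane → ℝ}, ContDiff ℝ ∞ f → Continuous (∇ f) := fun hf =>
      continuous_gradient (hf.continuous_fderiv (by simp))
    simp_rw [hgr]
    exact tendsto_eLpNorm_add (by rw [map_add]; exact Lp.coeFn_add _ _)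
      (fun m => (hc (hu m)).aestronglyMeasurable.sub (Lp.aestronglyMeasurable _))
      (fun m => (hc (hu' m)).aestronglyMeasurable.sub (Lp.aestronglyMeasurable _)) h2 h2'
  · exact tendsto_eLpNorm_add (by rfl)
      (fun m => ((hu m).continuous.sub hg).aestronglyMeasurable)
      (fun m => ((hu' m).continuous.sub hg').aestronglyMeasurable) h3 h3'

lemma HasContinuousTrace.smul (c : ℝ) {v : H1 P} {g : Plane → ℝ} (h : HasContinuousTrace v g) :
    HasContinuousTrace (c • v) (c • g) := by
  obtain ⟨hg, u, hu, h1, h2, h3⟩ := h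
  refine ⟨hg.const_smul c, fun m => c • u m, fun m => (hu m).const_smul c, ?_, ?_, ?_⟩
  · exact tendsto_eLpNorm_smul c (by rw [map_smul]; exact Lp.coeFn_smul _ _) h1
  · have hgr : ∀ m, ∇ (c • u m) = c • ∇ (u m) := by
      intro m
      ext1 x
      simp only [gradient, Pi.smul_apply]
      rw [fderiv_const_smul ((hu m).differentiable (by simp) x)]
      simp
    simp_rw [hgr]
    exact tendsto_eLpNorm_smul c (by rw [map_smul]; exact Lp.coeFn_smul _ _) h2
  · exact tendsto_eLpNorm_smul c (by rfl) h3

variable (P) in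
/-- The enlarged local space: functions in `H¹(P)` whose trace is continuous on the boundary and a
polynomial of degree at most `k` on each edge, and whose Laplacian is a polynomial of degree at
most `k`. -/
def enlargedSpace (k : ℕ) : Submodule ℝ (H1 P) where
  carrier := {v | (∃ g, HasContinuousTrace v g ∧
      ∀ i, ∃ r ∈ Polynomial.degreeLE ℝ k, ∀ t ∈ Set.Icc (0 : ℝ) 1,
        g (P.poly.edgePath ℝ i t) = r.eval t) ∧
    ∃ f ∈ polyL2Space P k, HasWeakLaplacian v f}
  zero_mem' := by
    refine ⟨⟨0, HasContinuousTrace.zero, fun i => ⟨0, zero_mem _, by simp⟩⟩, 0, zero_mem _, ?_⟩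
    simp [hasWeakLaplacian_iff]
  add_mem' := by
    rintro u v ⟨⟨g, hg, hr⟩, f, hf, hL⟩ ⟨⟨g', hg', hr'⟩, f', hf', hL'⟩
    refine ⟨⟨g + g', hg.add hg', fun i => ?_⟩, f + f', add_mem hf hf', ?_⟩
    · obtain ⟨r, hrk, hr⟩ := hr i
      obtain ⟨r', hrk', hr'⟩ := hr' i
      exact ⟨r + r', add_mem hrk hrk', fun t ht => by simp [hr t ht, hr' t ht]⟩
    · rw [hasWeakLaplacian_iff] at *
      intro ψ
      rw [map_add, inner_add_left, inner_add_left, hL ψ, hL' ψ]; ring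
  smul_mem' := by
    rintro c v ⟨⟨g, hg, hr⟩, f, hf, hL⟩
    refine ⟨⟨c • g, hg.smul c, fun i => ?_⟩, c • f, Submodule.smul_mem _ _ hf, ?_⟩
    · obtain ⟨r, hrk, hr⟩ := hr i
      exact ⟨c • r, Submodule.smul_mem _ _ hrk, fun t ht => by simp [hr t ht]⟩
    · rw [hasWeakLaplacian_iff] at *
      intro ψ
      rw [map_smul, real_inner_smul_left, real_inner_smul_left, hL ψ]; ring

/-- The equations that define the polynomial `q = Π^∇ v` of degree at most `k`:
`a^P(q - v, p) = 0` for all polynomials `p` of degree at most `k`, and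
`∫_{∂P} (q - v) ds = 0`. -/
def IsPiNabla (k : ℕ) (v : H1 P) (q : MvPolynomial (Fin 2) ℝ) : Prop :=
  q ∈ polySpace k ∧ (∀ p ∈ polySpace k, aForm (polyH1 P q - v) (polyH1 P p) = 0) ∧
    ∃ g, HasContinuousTrace v g ∧ ∫ x, (polyFun q x - g x) ∂P.arcLength = 0

open Classical in
/-- The projection `Π^∇`: the polynomial `q` determined by the equations above. -/
def piNabla (k : ℕ) (v : H1 P) : MvPolynomial (Fin 2) ℝ :=
  if h : ∃ q, IsPiNabla k v q then h.choose else 0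

variable (P) in
/-- The local virtual element space: those `v` in the enlarged space such that `v - Π^∇ v` is
`L²(P)`-orthogonal to every polynomial of degree at most `k` that is `L²(P)`-orthogonal to the
polynomials of degree at most `k - 2`. -/
def virtualSpace (k : ℕ) : Submodule ℝ (H1 P) where
  carrier := {v | v ∈ enlargedSpace P k ∧ ∃ q, IsPiNabla k v q ∧
    ∀ p ∈ polyL2Space P k ⊓ (polyL2Space P ((k : ℤ) - 2))ᗮ, bForm (val v - polyL2 P q) p = 0}
  zero_mem' := by
    refine ⟨zero_mem _, 0, ⟨zero_mem _, ?_, 0, HasContinuousTrace.zero, ?_⟩, ?_⟩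
    · simp [aForm]
    · simp [polyFun]
    · simp [bForm]
  add_mem' := by
    rintro u v ⟨hu, q, ⟨hq, ha, g, hg, hi⟩, ho⟩ ⟨hv, q', ⟨hq', ha', g', hg', hi'⟩, ho'⟩
    refine ⟨add_mem hu hv, q + q', ⟨add_mem hq hq', fun p hp => ?_, g + g', hg.add hg', ?_⟩,
      fun p hp => ?_⟩
    · have h1 := ha p hp
      have h2 := ha' p hp
      simp only [aForm, map_sub, map_add, inner_sub_left, inner_add_left] at *
      linarith
    · have e : (fun x => polyFun (q + q') x - (g + g') x)
          = fun x => (polyFun q x - g x) + (polyFun q' x - g' x) := by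
        ext x; simp only [polyFun_add, Pi.add_apply]; ring
      have i1 : Integrable (fun x => polyFun q x - g x) P.arcLength :=
        integrable_arcLength ((contDiff_polyFun q).continuous.sub hg.1)
      have i2 : Integrable (fun x => polyFun q' x - g' x) P.arcLength :=
        integrable_arcLength ((contDiff_polyFun q').continuous.sub hg'.1)
      rw [e, integral_add i1 i2, hi, hi', add_zero]
    · have h1 := ho p hp
      have h2 := ho' p hp
      simp only [bForm, map_add, inner_sub_left, inner_add_left] at *
      linarith
  smul_mem' := by
    rintro c v ⟨hv, q, ⟨hq, ha, g, hg, hi⟩, ho⟩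
    refine ⟨Submodule.smul_mem _ _ hv, c • q, ⟨Submodule.smul_mem _ _ hq, fun p hp => ?_,
      c • g, hg.smul c, ?_⟩, fun p hp => ?_⟩
    · have h1 := ha p hp
      rw [map_smul, aForm, ← smul_sub c (polyH1 P q) v, map_smul, real_inner_smul_left]
      rw [aForm] at h1
      rw [h1, mul_zero]
    · have e : (fun x => polyFun (c • q) x - (c • g) x)
          = fun x => c * (polyFun q x - g x) := by
        ext x; simp only [polyFun_smul, Pi.smul_apply, smul_eq_mul]; ring
      rw [e, integral_const_mul, hi, mul_zero]
    · have h1 := ho p hp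
      rw [map_smul, map_smul, bForm, ← smul_sub c (val v) (polyL2 P q), real_inner_smul_left]
      rw [bForm] at h1
      rw [h1, mul_zero]

/-- `Π^∇ v` as an element of `H¹(P)`. -/
def projNabla (k : ℕ) (v : H1 P) : H1 P := polyH1 P (piNabla k v)

/-- `Π⁰ v`: the `L²(P)`-orthogonal projection of `v` onto the polynomials of degree at most `k`. -/
def projZero (k : ℕ) (v : H1 P) : P.L2 := (polyL2Space P k).starProjection (val v)

/-! ### The local matrices -/

section LocalMatrices

variable {k : ℕ} {ι : Type*} [Fintype ι] (φ : Module.Basis ι ℝ (virtualSpace P k))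

/-- The matrix `A₁^P`, with entries `a^P(Π^∇ φᵢ, Π^∇ φⱼ)`. -/
def matA₁ : Matrix ι ι ℝ := .of fun i j => aForm (projNabla k (φ i : H1 P)) (projNabla k (φ j : H1 P))

/-- The matrix `A₂^P`, with entries `a^P((I - Π^∇) φᵢ, (I - Π^∇) φⱼ)`. -/
def matA₂ : Matrix ι ι ℝ := .of fun i j =>
  aForm ((φ i : H1 P) - projNabla k (φ i : H1 P)) ((φ j : H1 P) - projNabla k (φ j : H1 P))

/-- The matrix `B₁^P`, with entries `b^P(Π⁰ φᵢ, Π⁰ φⱼ)`. -/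
def matB₁ : Matrix ι ι ℝ := .of fun i j => bForm (projZero k (φ i : H1 P)) (projZero k (φ j : H1 P))

/-- The matrix `B₂^P`, with entries `b^P((I - Π⁰) φᵢ, (I - Π⁰) φⱼ)`. -/
def matB₂ : Matrix ι ι ℝ := .of fun i j =>
  bForm (val (φ i : H1 P) - projZero k (φ i : H1 P)) (val (φ j : H1 P) - projZero k (φ j : H1 P))

/-- The matrix of `a^P` in the basis `φ`. -/
def gramA : Matrix ι ι ℝ := .of fun i j => aForm (φ i : H1 P) (φ j : H1 P)

/-- The matrix of `b^P` in the basis `φ`. -/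
def gramB : Matrix ι ι ℝ := .of fun i j => bForm (val (φ i : H1 P)) (val (φ j : H1 P))

end LocalMatrices

end VEM

end

/-! Each pair consists of Gram matrices of an orthogonally split family. Let `f i` be the gradients
(for `A`) or the values (for `B`) of the basis functions, and let `W` be the gradients, respectively
the values, of the polynomials of degree at most `k`. The first matrix of the pair is the Gram
matrix of the projections of the `f i` onto `W`, the second that of the residuals. For `A` this
holds because the equations `a^P(Π^∇ v - v, p) = 0` say exactly that the gradient of `Π^∇ v` is the
orthogonal projection of the gradient of `v` (`grad_projNabla`); the boundary mean plays no role.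

All four matrices are therefore symmetric and positive semidefinite. Property c) only needs the span
of the `f i` to be invariant under the projection (`propertyC_gram`), and it is, because polynomials
belong to the virtual space (`polyH1_mem_virtualSpace`). Indeed, the residual `r` of `u` then lies
in the kernel of the first matrix. If `u` is orthogonal to that kernel, then `r` is orthogonal to
`u` as well as to the projection of `u`, hence to itself.

Property b) separates the two pairs. It follows from linear independence of the `f i`
(`propertyB_gram`). Values of basis functions are independent because the function determines its
weak gradient (`val_injective`), so `B` has every property and `B₁ + β B₂` is positive definite.
Gradients are dependent because constants have gradient zero, which gives a nonzero vector in both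
kernels of `A`. Finally, by semidefiniteness, the kernel of `A₁ + α A₂` is the intersection of the
two kernels (`eigenSolutions_zero_eq`). -/

noncomputable section

namespace VEM

/-! ### Gram matrices and orthogonal splittings -/

section GramSplitting

variable {ι E : Type*} [NormedAddCommGroup E] [InnerProductSpace ℝ E]

lemma isSymm_gram (f : ι → E) : (gram ℝ f).IsSymm :=
  Matrix.ext fun _ _ => real_inner_comm _ _

variable [Fintype ι]

lemma dotProduct_gram_mulVec (f : ι → E) (x y : ι → ℝ) :
    x ⬝ᵥ (gram ℝ f *ᵥ y) = inner ℝ (∑ i, x i • f i) (∑ i, y i • f i) := by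
  simpa using star_dotProduct_gram_mulVec (𝕜 := ℝ) f x y

/-- Pairing `gram ℝ f *ᵥ x` with `x` gives the squared norm of the combination, so the kernel of a
Gram matrix consists of the linear relations among the vectors. -/
lemma gram_mulVec_eq_zero_iff (f : ι → E) (x : ι → ℝ) :
    gram ℝ f *ᵥ x = 0 ↔ ∑ i, x i • f i = 0 := by
  refine ⟨fun h => ?_, fun h => ?_⟩
  · have := dotProduct_gram_mulVec f x x
    rw [h, dotProduct_zero] at this
    exact inner_self_eq_zero.1 this.symm
  · refine dotProduct_eq_zero_iff.1 fun y => ?_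
    rw [dotProduct_comm, dotProduct_gram_mulVec, h, inner_zero_right]

variable (W : Submodule ℝ E) [W.HasOrthogonalProjection]

lemma sum_smul_starProjection (f : ι → E) (x : ι → ℝ) :
    ∑ i, x i • W.starProjection (f i) = W.starProjection (∑ i, x i • f i) := by
  simp

lemma sum_smul_sub_starProjection (f : ι → E) (x : ι → ℝ) :
    ∑ i, x i • (f i - W.starProjection (f i)) =
      ∑ i, x i • f i - W.starProjection (∑ i, x i • f i) := by
  simp [smul_sub]

/-- Splitting a Gram matrix by an orthogonal projection that preserves the span of the vectors
gives a second part that vanishes on the orthogonal complement of the kernel of the first. -/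
lemma propertyC_gram (f : ι → E)
    (hf : ∀ x : ι → ℝ, ∃ y : ι → ℝ, ∑ i, y i • f i =
      ∑ i, x i • f i - W.starProjection (∑ i, x i • f i)) :
    PropertyC (gram ℝ f) (gram ℝ fun i => W.starProjection (f i))
      (gram ℝ fun i => f i - W.starProjection (f i)) := by
  intro x hx
  obtain ⟨y, hy⟩ := hf x
  set u := ∑ i, x i • f i with hu
  -- The vector `y` represents the residual of `u`, which the projection annihilates; it is thus an
  -- admissible test vector in `hx`.
  have hker : (gram ℝ fun i => W.starProjection (f i)) *ᵥ y = 0 := by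
    rw [gram_mulVec_eq_zero_iff, sum_smul_starProjection, hy, map_sub,
      W.starProjection_eq_self_iff.2 (W.starProjection_apply_mem u), sub_self]
  have h := hx y hker
  rw [dotProduct_gram_mulVec, hy, ← hu] at h
  have ho : inner ℝ (W.starProjection u) (u - W.starProjection u) = 0 := by
    rw [real_inner_comm]
    exact W.starProjection_inner_eq_zero u _ (W.starProjection_apply_mem u)
  rw [gram_mulVec_eq_zero_iff, sum_smul_sub_starProjection, ← hu,
    ← inner_self_eq_zero (𝕜 := ℝ), inner_sub_left, h, ho, sub_zero]

/-- For linearly independent vectors the second part is positive definite on the kernel of the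
first. -/
lemma propertyB_gram {f : ι → E} (hf : LinearIndependent ℝ f) :
    PropertyB (gram ℝ fun i => W.starProjection (f i))
      (gram ℝ fun i => f i - W.starProjection (f i)) := by
  refine ⟨posSemidef_gram ℝ _, fun x hx hx0 => ?_⟩
  -- On the kernel of the first matrix the projection of the combination is zero, so its residual is
  -- the whole combination.
  rw [gram_mulVec_eq_zero_iff, sum_smul_starProjection] at hx
  rw [dotProduct_gram_mulVec, sum_smul_sub_starProjection, hx, sub_zero, real_inner_self_eq_norm_sq]
  have : ∑ i, x i • f i ≠ 0 := fun h =>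
    hx0 (funext (Fintype.linearIndependent_iff.1 hf x h))
  positivity

end GramSplitting

/-! ### Positive combinations of semidefinite matrices -/

section Matrices

variable {ι : Type*} [Fintype ι]

lemma dotProduct_mulVec_nonneg {C : Matrix ι ι ℝ} (hC : C.PosSemidef) (x : ι → ℝ) :
    0 ≤ x ⬝ᵥ (C *ᵥ x) := by
  simpa using hC.dotProduct_mulVec_nonneg x

lemma mulVec_eq_zero_iff_of_posSemidef {C : Matrix ι ι ℝ} (hC : C.PosSemidef) (x : ι → ℝ) :
    C *ᵥ x = 0 ↔ x ⬝ᵥ (C *ᵥ x) = 0 := by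
  simpa using (hC.dotProduct_mulVec_zero_iff x).symm

/-- The kernel of a positive combination of positive semidefinite matrices. -/
lemma eigenSolutions_zero_eq {C₁ C₂ : Matrix ι ι ℝ} (h₁ : C₁.PosSemidef) (h₂ : C₂.PosSemidef)
    {α : ℝ} (hα : 0 < α) (B : Matrix ι ι ℝ) :
    eigenSolutions (C₁ + α • C₂) B 0 =
      LinearMap.ker C₁.mulVecLin ⊓ LinearMap.ker C₂.mulVecLin := by
  ext x
  simp only [eigenSolutions, zero_smul, sub_zero, LinearMap.mem_ker, mulVecLin_apply,
    Submodule.mem_inf, add_mulVec, smul_mulVec]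
  refine ⟨fun h => ?_, fun h => by simp [h.1, h.2]⟩
  -- Two nonnegative quadratic forms with zero sum vanish separately, and a semidefinite matrix
  -- kills every vector on which its form vanishes.
  have e : x ⬝ᵥ (C₁ *ᵥ x) + α * (x ⬝ᵥ (C₂ *ᵥ x)) = 0 := by
    simpa using congrArg (x ⬝ᵥ ·) h
  have n₁ := dotProduct_mulVec_nonneg h₁ x
  have n₂ := mul_nonneg hα.le (dotProduct_mulVec_nonneg h₂ x)
  rw [mulVec_eq_zero_iff_of_posSemidef h₁, mulVec_eq_zero_iff_of_posSemidef h₂]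
  refine ⟨by linarith, ?_⟩
  have : α * (x ⬝ᵥ (C₂ *ᵥ x)) = 0 := by linarith
  exact (mul_eq_zero.1 this).resolve_left hα.ne'

/-- Under properties a) and b) every positive combination is positive definite. -/
lemma PropertyB.posDef_add_smul {C₁ C₂ : Matrix ι ι ℝ} (ha : PropertyA C₁) (hb : PropertyB C₁ C₂)
    {β : ℝ} (hβ : 0 < β) : (C₁ + β • C₂).PosDef := by
  have ha' : C₁.PosSemidef := ha
  refine .of_dotProduct_mulVec_pos (ha'.1.add (hb.1.smul hβ.le).1) fun x hx => ?_
  have n₁ := dotProduct_mulVec_nonneg ha' x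
  have n₂ := dotProduct_mulVec_nonneg hb.1 x
  rw [star_trivial, add_mulVec, smul_mulVec, dotProduct_add, dotProduct_smul, smul_eq_mul]
  -- On the kernel of `C₁` strict positivity comes from `C₂` by property b); off the kernel it comes
  -- from `C₁` itself.
  by_cases h : C₁ *ᵥ x = 0
  · have := mul_pos hβ (hb.2 x h hx)
    linarith
  · have := n₁.lt_of_ne' fun h' => h ((mulVec_eq_zero_iff_of_posSemidef ha' x).2 h')
    have := mul_nonneg hβ.le n₂
    linarith

end Matrices

/-! ### Polynomials -/

lemma mem_polySpace_natCast {k : ℕ} {q : MvPolynomial (Fin 2) ℝ} :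
    q ∈ polySpace k ↔ q.totalDegree ≤ k :=
  MvPolynomial.mem_restrictTotalDegree _ _ _

/-- A monomial `m` of the derivative comes from the monomial `m + Finsupp.single i 1` of `q`. Hence
the Laplacian of a polynomial stays within degree `k`, as the enlarged space requires. -/
lemma totalDegree_pderiv_le {σ R : Type*} [CommSemiring R] (i : σ) (q : MvPolynomial σ R) :
    (MvPolynomial.pderiv i q).totalDegree ≤ q.totalDegree := by
  classical
  refine Finset.sup_le fun m hm => ?_
  have hm' : m + Finsupp.single i 1 ∈ q.support := by
    rw [MvPolynomial.mem_support_iff, MvPolynomial.coeff_pderiv] at hm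
    exact MvPolynomial.mem_support_iff.2 (left_ne_zero_of_mul hm)
  refine le_trans ?_ (MvPolynomial.le_totalDegree hm')
  rw [Finsupp.sum_add_index' (by simp) (by simp)]
  exact Nat.le_add_right _ _

/-- Identifies the analytic derivative with the formal one, so that partial derivatives of
polynomial functions are again polynomial functions. -/
lemma fderiv_polyFun (q : MvPolynomial (Fin 2) ℝ) (x e : Plane) :
    fderiv ℝ (polyFun q) x e = ∑ i, e i * polyFun (MvPolynomial.pderiv i q) x := by
  induction q using MvPolynomial.induction_on with
  | C a =>
    have : polyFun (MvPolynomial.C a) = fun _ => a := by ext; simp [polyFun]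
    simp [this, polyFun]
  | add p q hp hq =>
    rw [polyFun_add, fderiv_add (differentiable_polyFun p x) (differentiable_polyFun q x)]
    simp only [_root_.add_apply, hp, hq, map_add, polyFun_add, Pi.add_apply, mul_add,
      Finset.sum_add_distrib]
  | mul_X p j hp =>
    have e1 : polyFun (p * MvPolynomial.X j) =
        fun y => polyFun p y * (EuclideanSpace.proj j : Plane →L[ℝ] ℝ) y := by
      ext; simp [polyFun]
    have e3 : ∀ y, (EuclideanSpace.proj j : Plane →L[ℝ] ℝ) y = y j := fun _ => rfl
    rw [e1, fderiv_fun_mul (differentiable_polyFun p x)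
      (EuclideanSpace.proj j : Plane →L[ℝ] ℝ).differentiableAt, ContinuousLinearMap.fderiv]
    have e2 : ∀ i, polyFun (MvPolynomial.pderiv i (p * MvPolynomial.X j)) x =
        polyFun (MvPolynomial.pderiv i p) x * x j + polyFun p x * if i = j then 1 else 0 := by
      intro i
      rw [Derivation.leibniz, MvPolynomial.pderiv_X]
      by_cases h : i = j
      · subst h
        simp [polyFun]
        ring
      · simp [polyFun, h, mul_comm, Ne.symm h]
    simp only [e2, _root_.add_apply, _root_.smul_apply, hp, smul_eq_mul,
      e3, mul_add, Finset.sum_add_distrib, Finset.mul_sum]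
    rw [add_comm]
    congr 1
    · exact Finset.sum_congr rfl fun i _ => by ring
    · simp [mul_comm]

lemma gradient_apply (f : Plane → ℝ) (x : Plane) (i : Fin 2) :
    ∇ f x i = fderiv ℝ f x (EuclideanSpace.single i 1) := by
  rw [← InnerProductSpace.toDual_symm_apply (𝕜 := ℝ) (x := EuclideanSpace.single i 1)
    (y := fderiv ℝ f x), EuclideanSpace.inner_single_right]
  simp [gradient]

lemma gradient_polyFun_apply (q : MvPolynomial (Fin 2) ℝ) (x : Plane) (i : Fin 2) :
    ∇ (polyFun q) x i = polyFun (MvPolynomial.pderiv i q) x := by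
  rw [gradient_apply, fderiv_polyFun]
  simp

lemma eval_aeval_eq_polyFun {l : Fin 2 → Polynomial ℝ} {t : ℝ} {x : Plane}
    (h : ∀ i, (l i).eval t = x i) (q : MvPolynomial (Fin 2) ℝ) :
    (MvPolynomial.aeval l q).eval t = polyFun q x := by
  induction q using MvPolynomial.induction_on with
  | C a => simp [polyFun]
  | add p q hp hq => rw [map_add, Polynomial.eval_add, hp, hq, polyFun_add, Pi.add_apply]
  | mul_X p i hp =>
    rw [map_mul, Polynomial.eval_mul, hp, MvPolynomial.aeval_X, h]
    simp [polyFun]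

/-- The restriction of a polynomial to a segment is a polynomial of at most the same degree. -/
lemma exists_polynomial_lineMap (a b : Plane) {k : ℕ} {q : MvPolynomial (Fin 2) ℝ}
    (hq : q.totalDegree ≤ k) : ∃ r ∈ Polynomial.degreeLE ℝ k, ∀ t : ℝ,
      polyFun q (AffineMap.lineMap a b t) = r.eval t := by
  let l : Fin 2 → Polynomial ℝ := fun i =>
    Polynomial.C (b i - a i) * Polynomial.X + Polynomial.C (a i)
  -- Along the segment each coordinate is a polynomial of degree at most one in the parameter, so
  -- substitution does not raise the degree.
  have hl : (MvPolynomial.aeval l q).natDegree ≤ k * 1 :=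
    MvPolynomial.aeval_natDegree_le q hq l fun i => Polynomial.natDegree_linear_le
  rw [mul_one] at hl
  refine ⟨MvPolynomial.aeval l q,
    Polynomial.mem_degreeLE.2 (Polynomial.degree_le_of_natDegree_le hl),
    fun t => (eval_aeval_eq_polyFun (fun i => ?_) q).symm⟩
  simp only [l, Polynomial.eval_add, Polynomial.eval_mul, Polynomial.eval_C, Polynomial.eval_X,
    AffineMap.lineMap_apply_module, PiLp.add_apply, PiLp.smul_apply, smul_eq_mul]
  ring

/-! ### Polynomials in the virtual element space -/

variable {P : PolygonalDomain} {k : ℕ}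

lemma coeFn_polyL2 (q : MvPolynomial (Fin 2) ℝ) : polyL2 P q =ᵐ[P.area] polyFun q :=
  (memLp_of_continuous (P := P) (contDiff_polyFun q).continuous).coeFn_toLp

lemma coeFn_polyGrad (q : MvPolynomial (Fin 2) ℝ) : polyGrad P q =ᵐ[P.area] ∇ (polyFun q) :=
  (memLp_of_continuous (P := P) (continuous_gradient_polyFun q)).coeFn_toLp

lemma val_polyH1 (q : MvPolynomial (Fin 2) ℝ) : val (polyH1 P q) = polyL2 P q := rfl

lemma grad_polyH1 (q : MvPolynomial (Fin 2) ℝ) : grad (polyH1 P q) = polyGrad P q := rfl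

lemma hasContinuousTrace_polyH1 (q : MvPolynomial (Fin 2) ℝ) :
    HasContinuousTrace (polyH1 P q) (polyFun q) := by
  refine ⟨(contDiff_polyFun q).continuous, fun _ => polyFun q, fun _ => contDiff_polyFun q,
    ?_, ?_, ?_⟩
  · have h : polyFun q - (val (polyH1 P q) : Plane → ℝ) =ᵐ[P.area] 0 := by
      filter_upwards [coeFn_polyL2 (P := P) q] with x hx
      simp [val_polyH1, hx]
    simp [eLpNorm_congr_ae h]
  · have h : ∇ (polyFun q) - (grad (polyH1 P q) : Plane → Plane) =ᵐ[P.area] 0 := by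
      filter_upwards [coeFn_polyGrad (P := P) q] with x hx
      simp [grad_polyH1, hx]
    simp [eLpNorm_congr_ae h]
  · simp

/-- Each partial derivative of `q` is a polynomial, so its weak gradient is known; testing it in the
`i`-th coordinate direction and summing over `i` gives the claim. -/
lemma hasWeakLaplacian_polyH1 (q : MvPolynomial (Fin 2) ℝ) :
    HasWeakLaplacian (polyH1 P q)
      (polyL2 P (∑ i, MvPolynomial.pderiv i (MvPolynomial.pderiv i q))) := by
  intro ψ
  have hint : ∀ (f : P.L2) {w : Plane → ℝ}, Continuous w →
      Integrable (fun x => f x * w x) P.area := fun f w hw =>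
    (Lp.memLp f).integrable_mul (memLp_of_continuous hw)
  have h1 : ∫ x, inner ℝ (grad (polyH1 P q) x) (∇ ψ x) ∂P.area =
      ∑ i, ∫ x, polyL2 P (MvPolynomial.pderiv i q) x *
        fderiv ℝ ψ x (EuclideanSpace.single i 1) ∂P.area := by
    rw [← integral_finsetSum _ fun i _ =>
      hint _ ((continuous_fderiv_test ψ).clm_apply continuous_const)]
    refine integral_congr_ae ?_
    filter_upwards [coeFn_polyGrad (P := P) q,
      ae_all_iff.2 fun i => coeFn_polyL2 (P := P) (MvPolynomial.pderiv i q)] with x hx hx'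
    rw [grad_polyH1, hx, PiLp.inner_apply]
    refine Finset.sum_congr rfl fun i _ => ?_
    rw [hx', gradient_polyFun_apply, gradient_apply]
    simp [mul_comm]
  have h2 : ∀ i : Fin 2, ∫ x, polyL2 P (MvPolynomial.pderiv i q) x *
        fderiv ℝ ψ x (EuclideanSpace.single i 1) ∂P.area =
      -∫ x, polyL2 P (MvPolynomial.pderiv i (MvPolynomial.pderiv i q)) x * ψ x ∂P.area := by
    intro i
    rw [hasWeakGradient_poly (MvPolynomial.pderiv i q) ψ (EuclideanSpace.single i 1)]
    congr 1
    refine integral_congr_ae ?_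
    filter_upwards [coeFn_polyGrad (P := P) (MvPolynomial.pderiv i q),
      coeFn_polyL2 (P := P) (MvPolynomial.pderiv i (MvPolynomial.pderiv i q))] with x hx hx'
    rw [hx, hx', ← gradient_polyFun_apply, real_inner_smul_right,
      EuclideanSpace.inner_single_right]
    simp [mul_comm]
  rw [h1, Finset.sum_congr rfl fun i _ => h2 i, Finset.sum_neg_distrib,
    ← integral_finsetSum _ fun i _ => hint _ ψ.continuous]
  congr 1
  refine integral_congr_ae ?_
  filter_upwards [coeFn_polyL2 (P := P) (∑ i, MvPolynomial.pderiv i (MvPolynomial.pderiv i q)),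
      ae_all_iff.2 fun i => coeFn_polyL2 (P := P)
        (MvPolynomial.pderiv i (MvPolynomial.pderiv i q))] with x hx hx'
  rw [hx, ← Finset.sum_mul]
  simp [hx', polyFun]

lemma polyH1_mem_enlargedSpace {q : MvPolynomial (Fin 2) ℝ} (hq : q ∈ polySpace k) :
    polyH1 P q ∈ enlargedSpace P k := by
  rw [mem_polySpace_natCast] at hq
  refine ⟨⟨polyFun q, hasContinuousTrace_polyH1 q, fun i => ?_⟩, _,
    Submodule.mem_map_of_mem (sum_mem fun i _ => ?_), hasWeakLaplacian_polyH1 q⟩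
  · obtain ⟨r, hr, h⟩ := exists_polynomial_lineMap (P.poly i) (P.poly (finRotate P.n i)) hq
    exact ⟨r, hr, fun t _ => h t⟩
  · exact mem_polySpace_natCast.2
      ((totalDegree_pderiv_le i _).trans ((totalDegree_pderiv_le i q).trans hq))

lemma isPiNabla_polyH1 {q : MvPolynomial (Fin 2) ℝ} (hq : q ∈ polySpace k) :
    IsPiNabla k (polyH1 P q) q :=
  ⟨hq, by simp [aForm], polyFun q, hasContinuousTrace_polyH1 q, by simp⟩

/-- A polynomial of degree at most `k` solves its own equations for `Π^∇`, so the residual in the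
orthogonality constraint is zero. -/
lemma polyH1_mem_virtualSpace {q : MvPolynomial (Fin 2) ℝ} (hq : q ∈ polySpace k) :
    polyH1 P q ∈ virtualSpace P k :=
  ⟨polyH1_mem_enlargedSpace hq, q, isPiNabla_polyH1 hq, by simp [bForm, val_polyH1]⟩

/-! ### The projection `Π^∇` on gradients, and the kernels of value and gradient -/

variable (P) in
/-- The gradients of the polynomials of degree at most `d` as a subspace of `L²(P)²`. -/
def polyGradSpace (d : ℤ) : Submodule ℝ P.L2Vec := (polySpace d).map (polyGrad P)

instance (d : ℤ) : FiniteDimensional ℝ (polyGradSpace P d) := by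
  unfold polyGradSpace; infer_instance

/-- Membership in the virtual space includes solvability of the equations, so the default value `0`
of `piNabla` is not used. Uniqueness is not needed: the matrices `A` see only the gradient, which
the equations fix. -/
lemma isPiNabla_piNabla {v : H1 P} (hv : v ∈ virtualSpace P k) :
    IsPiNabla k v (piNabla k v) := by
  obtain ⟨-, q, hq, -⟩ := hv
  have h : ∃ q, IsPiNabla k v q := ⟨q, hq⟩
  rw [piNabla, dif_pos h]
  exact h.choose_spec

/-- The gradient of `Π^∇ v` is the orthogonal projection of the gradient of `v`. -/
lemma grad_projNabla {v : H1 P} (hv : v ∈ virtualSpace P k) :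
    grad (projNabla k v) = (polyGradSpace P k).starProjection (grad v) := by
  obtain ⟨hq, ha, -⟩ := isPiNabla_piNabla hv
  symm
  refine Submodule.eq_starProjection_of_mem_of_inner_eq_zero
    (Submodule.mem_map_of_mem hq) ?_
  rintro _ ⟨p, hp, rfl⟩
  have h := ha p hp
  rw [aForm, map_sub, grad_polyH1, grad_polyH1, inner_sub_left] at h
  rw [inner_sub_left, projNabla, grad_polyH1]
  linarith

/-- The weak gradient is determined by the function. -/
lemma val_injective : Function.Injective (val : H1 P →ₗ[ℝ] P.L2) := by
  rw [← LinearMap.ker_eq_bot, LinearMap.ker_eq_bot']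
  intro v hv
  have hG : HasWeakGradient (val v) (grad v) := v.2
  suffices h : grad v = 0 from Subtype.ext (Prod.ext hv h)
  rw [Lp.eq_zero_iff_ae_eq_zero]
  have hint : IntegrableOn (grad v) P.carrier volume :=
    (Lp.memLp (grad v)).integrable (by norm_num)
  -- Fundamental lemma of the calculus of variations: it suffices that `grad v` integrates to zero
  -- against every smooth function compactly supported in `P`.
  have key := P.carrier.isOpen.ae_eq_zero_of_integral_contDiff_smul_eq_zero
    hint.locallyIntegrableOn (fun g hg hc hs => ?_)
  · refine (ae_restrict_iff' P.carrier.isOpen.measurableSet).2 ?_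
    filter_upwards [key] with x hx hxP using hx hxP
  · have hz : ∀ x ∉ (P.carrier : Set Plane), g x • grad v x = 0 := fun x hx => by
      rw [image_eq_zero_of_notMem_tsupport fun h => hx (hs h), zero_smul]
    rw [← setIntegral_eq_integral_of_forall_compl_eq_zero hz]
    obtain ⟨C, hC⟩ := hc.exists_bound_of_continuous hg.continuous
    have hi : Integrable (fun x => g x • grad v x) P.area :=
      Integrable.bdd_smul hint C hg.continuous.aestronglyMeasurable
        (Eventually.of_forall hC)
    -- The vector integral is tested against each direction `e`, where the weak gradient identity
    -- with zero function applies.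
    refine ext_inner_left ℝ fun e => ?_
    have h := hG ⟨g, hg, hc, hs⟩ e
    rw [hv] at h
    have h0 : ∫ x, (0 : P.L2) x * fderiv ℝ (⟨g, hg, hc, hs⟩ : 𝓓(P.carrier, ℝ)) x e ∂P.area = 0 := by
      rw [← integral_zero Plane ℝ (μ := P.area)]
      refine integral_congr_ae ?_
      filter_upwards [Lp.coeFn_zero ℝ 2 P.area] with x hx
      rw [hx, Pi.zero_apply, zero_mul]
    rw [h0, eq_comm, neg_eq_zero] at h
    rw [← integral_inner hi, inner_zero_right, ← h]
    refine integral_congr_ae (Eventually.of_forall fun x => ?_)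
    change inner ℝ e (g x • grad v x) = inner ℝ (grad v x) (g x • e)
    rw [real_inner_smul_right, real_inner_smul_right, real_inner_comm]

/-- A nonempty open set has positive measure, so a nonzero constant is not almost everywhere zero on
`P`. -/
lemma polyL2_C_ne_zero {r : ℝ} (hr : r ≠ 0) : polyL2 P (MvPolynomial.C r) ≠ 0 := by
  intro h
  have h1 := coeFn_polyL2 (P := P) (MvPolynomial.C r)
  rw [h] at h1
  have h2 : ∀ᵐ _ ∂P.area, False := by
    filter_upwards [h1, Lp.coeFn_zero ℝ 2 P.area] with x hx hx'
    rw [hx'] at hx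
    exact hr (by simpa [polyFun] using hx.symm)
  have h3 : P.area = 0 := by simpa using h2
  exact (P.carrier.isOpen.measure_pos volume P.nonempty).ne' (Measure.restrict_eq_zero.1 h3)

lemma polyGrad_C (r : ℝ) : polyGrad P (MvPolynomial.C r) = 0 := by
  rw [Lp.eq_zero_iff_ae_eq_zero]
  filter_upwards [coeFn_polyGrad (P := P) (MvPolynomial.C r)] with x hx
  rw [hx]
  ext i
  rw [gradient_polyFun_apply]
  simp [polyFun]

/-! ### The local matrices as Gram matrices -/

section LocalMatrices

variable {ι : Type*} (φ : Module.Basis ι ℝ (virtualSpace P k))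

/-- An injective linear map sends a basis of a subspace to linearly independent vectors. -/
lemma linearIndependent_map_basis {V E : Type*} [AddCommGroup V] [Module ℝ V] [AddCommGroup E]
    [Module ℝ E] {p : Submodule ℝ V} (b : Module.Basis ι ℝ p) {T : V →ₗ[ℝ] E}
    (hT : Function.Injective T) : LinearIndependent ℝ fun i => T (b i : V) :=
  b.linearIndependent.map' (T ∘ₗ p.subtype)
    (LinearMap.ker_eq_bot.2 (hT.comp p.injective_subtype))

lemma gramA_eq_gram : gramA φ = gram ℝ fun i => grad (φ i : H1 P) := rfl

lemma gramB_eq_gram : gramB φ = gram ℝ fun i => val (φ i : H1 P) := rfl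

lemma matA₁_eq_gram : matA₁ φ =
    gram ℝ fun i => (polyGradSpace P k).starProjection (grad (φ i : H1 P)) := by
  ext i j
  simp only [matA₁, of_apply, aForm, grad_projNabla (φ _).2, gram_apply]

lemma matA₂_eq_gram : matA₂ φ = gram ℝ fun i => grad (φ i : H1 P) -
    (polyGradSpace P k).starProjection (grad (φ i : H1 P)) := by
  ext i j
  simp only [matA₂, of_apply, aForm, map_sub, grad_projNabla (φ _).2, gram_apply]

lemma matB₁_eq_gram : matB₁ φ =
    gram ℝ fun i => (polyL2Space P k).starProjection (val (φ i : H1 P)) := rfl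

lemma matB₂_eq_gram : matB₂ φ = gram ℝ fun i => val (φ i : H1 P) -
    (polyL2Space P k).starProjection (val (φ i : H1 P)) := rfl

variable [Fintype ι]

lemma sum_smul_map_basis {E : Type*} [AddCommGroup E] [Module ℝ E] (T : H1 P →ₗ[ℝ] E)
    (x : ι → ℝ) : ∑ i, x i • T (φ i : H1 P) =
      T ((∑ i, x i • φ i : virtualSpace P k) : H1 P) := by
  simp

/-- Every element of the virtual space has coordinates in the basis. -/
lemma exists_coordinates {v : H1 P} (hv : v ∈ virtualSpace P k) :
    ∃ x : ι → ℝ, ((∑ i, x i • φ i : virtualSpace P k) : H1 P) = v :=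
  ⟨φ.repr ⟨v, hv⟩, by rw [φ.sum_repr]⟩

/-- If the image of the polynomials under `T` is `W`, then the projection onto `W` preserves the
image of the virtual space. -/
lemma exists_coordinates_sub_starProjection {E : Type*} [NormedAddCommGroup E]
    [InnerProductSpace ℝ E] (T : H1 P →ₗ[ℝ] E) (W : Submodule ℝ E) [W.HasOrthogonalProjection]
    (hW : ∀ w ∈ W, ∃ q ∈ polySpace k, T (polyH1 P q) = w) (x : ι → ℝ) :
    ∃ y : ι → ℝ, ∑ i, y i • T (φ i : H1 P) = ∑ i, x i • T (φ i : H1 P) -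
      W.starProjection (∑ i, x i • T (φ i : H1 P)) := by
  -- The projection is the image of a polynomial `q`, and `q` lies in the virtual space; subtracting
  -- it therefore stays in that space.
  obtain ⟨q, hq, h⟩ := hW _ (W.starProjection_apply_mem (∑ i, x i • T (φ i : H1 P)))
  obtain ⟨y, hy⟩ := exists_coordinates φ
    (sub_mem (∑ i, x i • φ i : virtualSpace P k).2 (polyH1_mem_virtualSpace hq))
  refine ⟨y, ?_⟩
  rw [← h, sum_smul_map_basis, hy, map_sub, sum_smul_map_basis]

lemma propertyC_matA : PropertyC (gramA φ) (matA₁ φ) (matA₂ φ) := by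
  rw [gramA_eq_gram, matA₁_eq_gram, matA₂_eq_gram]
  refine propertyC_gram _ _ (exists_coordinates_sub_starProjection φ grad _ ?_)
  rintro _ ⟨q, hq, rfl⟩
  exact ⟨q, hq, rfl⟩

lemma propertyC_matB : PropertyC (gramB φ) (matB₁ φ) (matB₂ φ) := by
  rw [gramB_eq_gram, matB₁_eq_gram, matB₂_eq_gram]
  refine propertyC_gram _ _ (exists_coordinates_sub_starProjection φ val _ ?_)
  rintro _ ⟨q, hq, rfl⟩
  exact ⟨q, hq, rfl⟩

lemma posSemidef_matA₁ : (matA₁ φ).PosSemidef := by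
  rw [matA₁_eq_gram]
  exact posSemidef_gram ℝ _

lemma posSemidef_matA₂ : (matA₂ φ).PosSemidef := by
  rw [matA₂_eq_gram]
  exact posSemidef_gram ℝ _

lemma splittingAssumption_matB : SplittingAssumption (gramB φ) (matB₁ φ) (matB₂ φ) where
  symm₁ := isSymm_gram _
  symm₂ := isSymm_gram _
  a := posSemidef_gram ℝ _
  b := propertyB_gram _ (linearIndependent_map_basis φ val_injective)
  c := propertyC_matB φ

/-- The constants belong to the virtual space and lie in the kernels of both parts of `a^P`. -/
lemma exists_coordinates_const (r : ℝ) : ∃ c : ι → ℝ,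
    ((∑ i, c i • φ i : virtualSpace P k) : H1 P) = polyH1 P (MvPolynomial.C r) ∧
      matA₁ φ *ᵥ c = 0 ∧ matA₂ φ *ᵥ c = 0 := by
  obtain ⟨c, hc⟩ := exists_coordinates φ (polyH1_mem_virtualSpace (P := P) (k := k)
    (q := MvPolynomial.C r) (mem_polySpace_natCast.2 (by simp)))
  -- Both matrices see the coordinates only through the combined gradient, which is zero for a
  -- constant.
  have h0 : ∑ i, c i • grad (φ i : H1 P) = 0 := by
    rw [sum_smul_map_basis, hc, grad_polyH1, polyGrad_C]
  refine ⟨c, hc, ?_, ?_⟩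
  · rw [matA₁_eq_gram, gram_mulVec_eq_zero_iff, sum_smul_starProjection, h0, map_zero]
  · rw [matA₂_eq_gram, gram_mulVec_eq_zero_iff, sum_smul_sub_starProjection, h0, map_zero, sub_zero]

lemma exists_ne_zero_mulVec_matA_eq_zero :
    ∃ c : ι → ℝ, c ≠ 0 ∧ matA₁ φ *ᵥ c = 0 ∧ matA₂ φ *ᵥ c = 0 := by
  obtain ⟨c, hc, h₁, h₂⟩ := exists_coordinates_const φ 1
  refine ⟨c, ?_, h₁, h₂⟩
  rintro rfl
  -- Zero coordinates would make the constant function one vanish in `L²(P)`.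
  refine polyL2_C_ne_zero (P := P) one_ne_zero ?_
  rw [← val_polyH1, ← hc]
  simp

end LocalMatrices

end VEM

end

open VEM in
theorem mainTheorem4 (P : PolygonalDomain) (γ : ℝ) (hγ : 0 < γ) (hP : P.MeshRegular γ)
    (k : ℕ) (hk : 1 ≤ k) {ι : Type*} [Fintype ι] (φ : Module.Basis ι ℝ (virtualSpace P k)) :
    -- the stabilizing part of `A` vanishes on the orthogonal complement of the kernel
    PropertyC (gramA φ) (matA₁ φ) (matA₂ φ) ∧
    -- the constants belong to the local space and lie in both kernels
    (∀ r : ℝ, ∃ c : ι → ℝ, ((∑ i, c i • φ i : virtualSpace P k) : H1 P) =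
        polyH1 P (MvPolynomial.C r) ∧ matA₁ φ *ᵥ c = 0 ∧ matA₂ φ *ᵥ c = 0) ∧
    -- property a) and the semidefiniteness in property b) hold, but property b) fails
    PropertyA (matA₁ φ) ∧ (matA₂ φ).PosSemidef ∧ ¬ PropertyB (matA₁ φ) (matA₂ φ) ∧
    -- the kernels intersect nontrivially, and the dimension of the intersection is the
    -- multiplicity of the eigenvalue zero
    0 < Module.finrank ℝ ↥(LinearMap.ker (matA₁ φ).mulVecLin ⊓
        LinearMap.ker (matA₂ φ).mulVecLin) ∧
    (∀ α β : ℝ, 0 < α → 0 < β → (matB₁ φ + β • matB₂ φ).PosDef ∧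
      Module.finrank ℝ (eigenSolutions (matA₁ φ + α • matA₂ φ) (matB₁ φ + β • matB₂ φ) 0) =
        Module.finrank ℝ ↥(LinearMap.ker (matA₁ φ).mulVecLin ⊓
          LinearMap.ker (matA₂ φ).mulVecLin)) ∧
    -- the pair `B₁`, `B₂` satisfies all the properties
    SplittingAssumption (gramB φ) (matB₁ φ) (matB₂ φ) := by
  obtain ⟨c, hc0, hc₁, hc₂⟩ := exists_ne_zero_mulVec_matA_eq_zero φ
  have hB := splittingAssumption_matB φ
  refine ⟨propertyC_matA φ, exists_coordinates_const φ, posSemidef_matA₁ φ, posSemidef_matA₂ φ,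
    fun h => ?_, ?_, fun α β hα hβ => ⟨PropertyB.posDef_add_smul hB.a hB.b hβ, ?_⟩, hB⟩
  -- At the common kernel vector `c`, property b) would read `0 < 0`.
  · have := h.2 c hc₁ hc0
    rw [hc₂, dotProduct_zero] at this
    exact this.false
  · rw [Module.finrank_pos_iff_exists_ne_zero]
    exact ⟨⟨c, by simp [hc₁], by simp [hc₂]⟩, fun h => hc0 (congrArg Subtype.val h)⟩
  · rw [eigenSolutions_zero_eq (posSemidef_matA₁ φ) (posSemidef_matA₂ φ) hα]
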